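/- A $2$-factor on $n$ vertices is a $2$-regular graph with $n$ vertices, and a $2$-coloring of $K_n$ is a coloring of its edges with two colors. A copy of $F$ in $K_n$ is a subgraph of $K_n$ isomorphic to $F$. (1) There is a function $\delta:\mathbb{N}\to\mathbb{R}$ with $\delta(n)\to 0$ as $n\to\infty$ such that, for every $n$, every $n$-vertex $2$-factor $F$ and every $2$-coloring of $K_n$, there is a copy of $F$ in $K_n$ with at least $\left(\tfrac23-\delta(n)\right)n$ edges of the same color. (2) The constant $\tfrac23$ is optimal: if $r$ is a real number such that (1) holds with $r$ in place of $\tfrac23$ (for some function $\delta$ with $\delta(n)\to 0$), then $r\le\tfrac23$. (3) The bipartite construction with ratio $\tfrac13$ is extremal: if $V(K_n)=X\cup Y$ is a partition with $|X|=\tfrac13 n$, and all edges touching $X$ get one color while all edges inside $Y$ get the other color, then every copy in $K_n$ of every $n$-vertex $2$-factor has at most $\tfrac23 n$ edges of each color. -/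

import Mathlib

open Filter Topology

namespace TwoFactor

/-- A 2-coloring of the edges of the complete graph on the vertex set `Fin n`. -/
abbrev Coloring (n : ℕ) : Type := SimpleGraph.TopEdgeLabeling (Fin n) Bool

/-- The number of edges of the subgraph `H` of `K_n` that have color `i` under `c`. -/
noncomputable def colorCount {n : ℕ} (c : Coloring n) (H : SimpleGraph (Fin n)) (i : Bool) : ℕ :=
  {e | e ∈ H.edgeSet ∧ e ∈ (c.labelGraph i).edgeSet}.ncard

/-- `Guaranteed r`: for every `n` and every `n`-vertex 2-factor (2-regular graph) `F`, every
2-coloring of `K_n` has a copy of `F` with at least `(r - o(1)) n` edges of the same color, where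
the `o(1)` term `δ n` depends on `n` only. -/
def Guaranteed (r : ℝ) : Prop :=
  ∃ δ : ℕ → ℝ, Tendsto δ atTop (𝓝 0) ∧
    ∀ (n : ℕ) (F : SimpleGraph (Fin n)) [F.LocallyFinite], F.IsRegularOfDegree 2 →
      ∀ c : Coloring n, ∃ H : SimpleGraph (Fin n), Nonempty (F ≃g H) ∧
        ∃ i : Bool, (r - δ n) * (n : ℝ) ≤ (colorCount c H i : ℝ)

/-- The bipartite construction with parts `X` and `Y = Xᶜ`: the edges touching `X` have color `a`,
the edges inside `Y` have the other color. Its ratio is `|X| / n`. -/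
def bipartiteConstruction {n : ℕ} (X : Finset (Fin n)) (a : Bool) : Coloring n :=
  fun e => if ∃ v ∈ X, v ∈ (e : Sym2 (Fin n)) then a else !a

end TwoFactor

namespace TwoFactor

/-! The vertex set is tiled by blocks of bounded size on which the coloring is controlled, and the
2-factor is laid along the tiling. A graph of maximum degree two can be split into parts of any
sizes by cutting at most two edges (`exists_small_cut`), so each block costs O(1), and large blocks
cost a small fraction of `n` in total (`HasEmb.union`). `HasEmb` records values valid for all `G` at
once, so color and tiling are chosen before the 2-factor.

Ramsey's theorem splits the vertices into `R`, rich in `A`-cliques, and `B`, rich in `Aᶜ`-cliques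
(`exists_rich_split`). If one part contains two thirds of the vertices, tiling it by its own cliques
suffices. Otherwise the two colors are played against each other: take an `A`-clique in `R` and an
`Aᶜ`-clique in `B`, of sizes 2t and t in either order, with a monochromatic join between them
(`exists_mono_join`). The values of the two colors on such a block add up to at least 8t - 8. Tiling
almost everything by these blocks (`exists_emb_balanced`) gives values with sum about 8n/3, so one
color gets about 4n/3 ordered pairs, that is 2n/3 edges.

For optimality, the edges touching `X` number at most 2|X| in a 2-factor and those inside `Xᶜ` at
most |Xᶜ|; both bounds equal 2n/3 when |X| = n/3. -/

open Classical in
/-- The number of pairs in `S ×ˢ T` that satisfy `r`, as a real number. -/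
noncomputable def pairs {V : Type*} (r : V → V → Prop) (S T : Finset V) : ℝ :=
  ∑ a ∈ S, ∑ b ∈ T, if r a b then 1 else 0

/-- Every vertex has at most two neighbours. -/
def MaxDegTwo {V : Type*} (G : SimpleGraph V) : Prop :=
  ∀ (v : V) (T : Finset V), pairs G.Adj {v} T ≤ 2

/-- Every graph `G` of maximum degree at most two on `|U|` vertices can be placed on `U` so that
the number of ordered pairs of adjacent vertices placed on edges of `A` is at least `y`, up to a
loss of twice the total degree deficiency of `G`. -/
def HasEmb {V : Type*} (A : SimpleGraph V) (U : Finset V) (y : ℝ) : Prop :=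
  ∀ G : SimpleGraph V, MaxDegTwo G → ∀ W : Finset V, W.card = U.card →
    ∃ f : V → V, Set.BijOn f W U ∧
      y + 2 * pairs G.Adj W W ≤
        pairs (fun a b => G.Adj a b ∧ A.Adj (f a) (f b)) W W + 4 * (W.card : ℝ)

/-! ### Pair counts, small cuts and independent sets in graphs of maximum degree two. -/

section Pairs

variable {V : Type*} {r r' : V → V → Prop} {S S' T T' : Finset V}

lemma pairs_nonneg : 0 ≤ pairs r S T := by
  unfold pairs; positivity

open Classical in
lemma pairs_mono (hS : S ⊆ S') (hT : T ⊆ T') (h : ∀ a ∈ S, ∀ b ∈ T, r a b → r' a b) :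
    pairs r S T ≤ pairs r' S' T' := by
  unfold pairs
  calc _ ≤ ∑ a ∈ S, ∑ b ∈ T, (if r' a b then (1 : ℝ) else 0) := by
        refine Finset.sum_le_sum fun a ha => Finset.sum_le_sum fun b hb => ?_
        have := h a ha b hb
        split_ifs <;> simp_all
    _ ≤ ∑ a ∈ S, ∑ b ∈ T', (if r' a b then (1 : ℝ) else 0) := by
        refine Finset.sum_le_sum fun a _ => ?_
        exact Finset.sum_le_sum_of_subset_of_nonneg hT fun _ _ _ => by positivity
    _ ≤ _ := Finset.sum_le_sum_of_subset_of_nonneg hS fun _ _ _ => by positivity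

lemma pairs_swap (h : ∀ a b, r a b → r b a) : pairs r S T = pairs r T S := by
  unfold pairs
  rw [Finset.sum_comm]
  refine Finset.sum_congr rfl fun a _ => Finset.sum_congr rfl fun b _ => ?_
  rw [show r b a ↔ r a b from ⟨h _ _, h _ _⟩]

lemma pairs_eq_sum : pairs r S T = ∑ a ∈ S, pairs r {a} T := by simp [pairs]

lemma pairs_le_two_mul {G : SimpleGraph V} (hG : MaxDegTwo G) :
    pairs G.Adj S T ≤ 2 * (S.card : ℝ) := by
  rw [pairs_eq_sum]
  calc _ ≤ ∑ a ∈ S, (2 : ℝ) := Finset.sum_le_sum fun a _ => hG a T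
    _ = _ := by simp [mul_comm]

lemma pairs_eq_zero (h : ∀ a ∈ S, ∀ b ∈ T, ¬ r a b) : pairs r S T = 0 := by
  unfold pairs
  exact Finset.sum_eq_zero fun a ha => Finset.sum_eq_zero fun b hb => by simp [h a ha b hb]

lemma one_le_pairs {a b : V} (ha : a ∈ S) (hb : b ∈ T) (h : r a b) : 1 ≤ pairs r S T := by
  have : pairs r {a} {b} ≤ pairs r S T := pairs_mono (by simpa) (by simpa) fun _ _ _ _ h => h
  calc (1 : ℝ) = pairs r {a} {b} := by simp only [pairs, Finset.sum_singleton, if_pos h]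
    _ ≤ _ := this

open Classical in
lemma MaxDegTwo.card_filter_le {G : SimpleGraph V} (hG : MaxDegTwo G) (v : V) (T : Finset V) :
    (T.filter (G.Adj v)).card ≤ 2 := by
  have := hG v T
  simp only [pairs, Finset.sum_singleton, Finset.sum_boole] at this
  exact_mod_cast this

variable [DecidableEq V]

lemma pairs_union_left (h : Disjoint S S') : pairs r (S ∪ S') T = pairs r S T + pairs r S' T := by
  unfold pairs; rw [Finset.sum_union h]

lemma pairs_union_right (h : Disjoint T T') : pairs r S (T ∪ T') = pairs r S T + pairs r S T' := by
  unfold pairs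
  rw [← Finset.sum_add_distrib]
  exact Finset.sum_congr rfl fun a _ => Finset.sum_union h

/-- In a graph of maximum degree two, every vertex set has subsets of all sizes that send at most
two edges to the rest. -/
lemma exists_small_cut {G : SimpleGraph V} (hG : MaxDegTwo G) (W : Finset V) :
    ∀ k ≤ W.card, ∃ S ⊆ W, S.card = k ∧ pairs G.Adj S (W \ S) ≤ 2 := by
  intro k
  induction k with
  | zero => exact fun _ => ⟨∅, by simp, by simp, by simp [pairs]⟩
  | succ k ih =>
    intro hk
    obtain ⟨S, hSW, hS, hcut⟩ := ih (by omega)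
    have key : ∀ u ∈ W \ S, ∃ S' ⊆ W, S'.card = k + 1 ∧
        pairs G.Adj S' (W \ S') ≤ pairs G.Adj S (W \ S) + 2 - 2 * pairs G.Adj S {u} := by
      intro u hu
      obtain ⟨huW, huS⟩ := Finset.mem_sdiff.1 hu
      refine ⟨S ∪ {u}, Finset.union_subset hSW (by simpa), ?_, ?_⟩
      · rw [Finset.card_union_of_disjoint (by simpa), hS, Finset.card_singleton]
      · have h1 : W \ S = (W \ (S ∪ {u})) ∪ {u} := by grind
        have h2 : pairs G.Adj S (W \ S) = pairs G.Adj S (W \ (S ∪ {u})) + pairs G.Adj S {u} := by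
          conv_lhs => rw [h1]
          exact pairs_union_right (by simp)
        have h3 : pairs G.Adj {u} (S ∪ (W \ (S ∪ {u}))) =
            pairs G.Adj {u} S + pairs G.Adj {u} (W \ (S ∪ {u})) :=
          pairs_union_right (by rw [Finset.disjoint_left]; grind)
        have h4 : pairs G.Adj {u} S = pairs G.Adj S {u} := pairs_swap fun _ _ h => h.symm
        have h5 := hG u (S ∪ (W \ (S ∪ {u})))
        rw [pairs_union_left (by simpa)]
        linarith
    -- Adding a neighbour of `S` does not increase the cut; if there is none, the cut is empty and
    -- any new vertex contributes at most two.
    by_cases hex : ∃ u ∈ W \ S, ∃ s ∈ S, G.Adj s u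
    · obtain ⟨u, hu, s, hs, hadj⟩ := hex
      obtain ⟨S', h1, h2, h3⟩ := key u hu
      have := one_le_pairs (r := G.Adj) hs (Finset.mem_singleton_self u) hadj
      exact ⟨S', h1, h2, by linarith⟩
    · push Not at hex
      have hne : (W \ S).Nonempty := by
        rw [← Finset.card_pos, Finset.card_sdiff_of_subset hSW]; omega
      obtain ⟨u, hu⟩ := hne
      obtain ⟨S', h1, h2, h3⟩ := key u hu
      have h0 : pairs G.Adj S (W \ S) = 0 := pairs_eq_zero fun a ha b hb => hex b hb a ha
      have := pairs_nonneg (r := G.Adj) (S := S) (T := {u})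
      exact ⟨S', h1, h2, by linarith⟩

/-- Greedy choice: each chosen vertex excludes only itself and at most two neighbours. -/
lemma exists_independent {G : SimpleGraph V} (hG : MaxDegTwo G) (W : Finset V) :
    ∀ k, 3 * k ≤ W.card → ∃ Z ⊆ W, Z.card = k ∧ ∀ a ∈ Z, ∀ b ∈ Z, ¬ G.Adj a b := by
  classical
  intro k
  induction k with
  | zero => exact fun _ => ⟨∅, by simp, by simp, by simp⟩
  | succ k ih =>
    intro hk
    obtain ⟨Z, hZW, hZ, hind⟩ := ih (by omega)
    have hN : (Z.biUnion fun z => W.filter (G.Adj z)).card ≤ k * 2 := by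
      rw [← hZ]
      exact Finset.card_biUnion_le_card_mul _ _ _ fun z _ => hG.card_filter_le z W
    have hlt : (Z ∪ Z.biUnion fun z => W.filter (G.Adj z)).card < W.card :=
      (Finset.card_union_le _ _).trans_lt (by omega)
    obtain ⟨u, huW, hu⟩ := Finset.exists_mem_notMem_of_card_lt_card hlt
    simp only [Finset.mem_union, Finset.mem_biUnion, Finset.mem_filter, not_or, not_exists,
      not_and] at hu
    have hadj : ∀ z ∈ Z, ¬ G.Adj z u := fun z hz => hu.2 z hz huW
    refine ⟨insert u Z, Finset.insert_subset huW hZW, by simp [hu.1, hZ], ?_⟩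
    intro a ha b hb
    rcases Finset.mem_insert.1 ha with ha | ha <;> rcases Finset.mem_insert.1 hb with hb | hb
    · rw [ha, hb]; exact G.loopless.irrefl _
    · rw [ha]; exact fun h => hadj b hb h.symm
    · rw [hb]; exact hadj a ha
    · exact hind a ha b hb

end Pairs

/-! ### Values of single blocks and of disjoint unions. -/

section HasEmb

variable {V : Type*} {A : SimpleGraph V} {U U₁ U₂ P Q : Finset V}

lemma exists_bijOn {W U : Finset V} (h : W.card = U.card) : ∃ f : V → V, Set.BijOn f W U := by
  rcases W.eq_empty_or_nonempty with rfl | ⟨w, hw⟩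
  · have : U = ∅ := by simpa using h.symm
    exact ⟨id, by simp [this]⟩
  · have : Nonempty V := ⟨w⟩
    exact W.finite_toSet.exists_bijOn_of_encard_eq (by simp [h])

/-- Absorbs leftover vertices, which may be placed arbitrarily. -/
lemma HasEmb.zero : HasEmb A U 0 := by
  intro G hG W hW
  obtain ⟨f, hf⟩ := exists_bijOn hW
  refine ⟨f, hf, ?_⟩
  have := pairs_le_two_mul hG (S := W) (T := W)
  have := pairs_nonneg (r := fun a b => G.Adj a b ∧ A.Adj (f a) (f b)) (S := W) (T := W)
  linarith

lemma HasEmb.mono {x y : ℝ} (h : HasEmb A U y) (hxy : x ≤ y) : HasEmb A U x := by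
  intro G hG W hW
  obtain ⟨f, hf, h⟩ := h G hG W hW
  exact ⟨f, hf, by linarith⟩

lemma HasEmb.of_isClique (h : A.IsClique (U : Set V)) : HasEmb A U (2 * U.card) := by
  intro G hG W hW
  obtain ⟨f, hf⟩ := exists_bijOn hW
  refine ⟨f, hf, ?_⟩
  have h1 := pairs_le_two_mul hG (S := W) (T := W)
  have h2 : pairs G.Adj W W ≤ pairs (fun a b => G.Adj a b ∧ A.Adj (f a) (f b)) W W :=
    pairs_mono subset_rfl subset_rfl fun a ha b hb hab =>
      ⟨hab, h (hf.mapsTo ha) (hf.mapsTo hb) fun he => hab.ne (hf.injOn ha hb he)⟩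
  rw [← hW]
  linarith

variable [DecidableEq V]

/-- Bijections on the two parts of a disjoint union combine to one on the union. -/
lemma exists_bijOn_union {W₁ W₂ : Finset V} {f₁ f₂ : V → V} (h₁ : Set.BijOn f₁ W₁ U₁)
    (h₂ : Set.BijOn f₂ W₂ U₂) (hW : Disjoint W₁ W₂) (hU : Disjoint U₁ U₂) :
    ∃ f : V → V, Set.BijOn f (W₁ ∪ W₂ : Finset V) (U₁ ∪ U₂ : Finset V) ∧
      (∀ a ∈ W₁, f a = f₁ a) ∧ ∀ a ∈ W₂, f a = f₂ a := by
  have e₁ : Set.EqOn (fun a => if a ∈ W₁ then f₁ a else f₂ a) f₁ W₁ := fun a ha => by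
    simp [Finset.mem_coe.1 ha]
  have e₂ : Set.EqOn (fun a => if a ∈ W₁ then f₁ a else f₂ a) f₂ W₂ := fun a ha => by
    simp [Finset.disjoint_right.1 hW ha]
  have b₁ := h₁.congr e₁.symm
  have b₂ := h₂.congr e₂.symm
  refine ⟨_, ?_, e₁, e₂⟩
  rw [Finset.coe_union, Finset.coe_union]
  refine b₁.union b₂ ?_
  rw [Set.injOn_union (by exact_mod_cast hW)]
  refine ⟨b₁.injOn, b₂.injOn, fun a ha b hb hab => ?_⟩
  exact Finset.disjoint_left.1 hU (b₁.mapsTo ha) (hab ▸ b₂.mapsTo hb)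

/-- Cutting at most two edges of `G` raises the total degree deficiency by at most 4, and deficiency
is charged twice: hence the 8. -/
lemma HasEmb.union {y₁ y₂ : ℝ} (h₁ : HasEmb A U₁ y₁) (h₂ : HasEmb A U₂ y₂)
    (hU : Disjoint U₁ U₂) : HasEmb A (U₁ ∪ U₂) (y₁ + y₂ - 8) := by
  intro G hG W hW
  rw [Finset.card_union_of_disjoint hU] at hW
  obtain ⟨W₁, hW₁, hc, hcut⟩ := exists_small_cut hG W U₁.card (by omega)
  have hdisj : Disjoint W₁ (W \ W₁) := Finset.disjoint_sdiff
  have hWu : W₁ ∪ (W \ W₁) = W := Finset.union_sdiff_of_subset hW₁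
  have hcard := Finset.card_sdiff_add_card_eq_card hW₁
  obtain ⟨f₁, b₁, i₁⟩ := h₁ G hG W₁ hc
  obtain ⟨f₂, b₂, i₂⟩ := h₂ G hG (W \ W₁) (by omega)
  obtain ⟨f, b, e₁, e₂⟩ := exists_bijOn_union b₁ b₂ hdisj hU
  rw [hWu] at b
  refine ⟨f, b, ?_⟩
  set W₂ := W \ W₁
  have hcardR : (W.card : ℝ) = W₁.card + W₂.card := by
    rw [← hcard]; push_cast; ring
  have hadj : pairs G.Adj W W =
      pairs G.Adj W₁ W₁ + 2 * pairs G.Adj W₁ W₂ + pairs G.Adj W₂ W₂ := by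
    have : pairs G.Adj W₂ W₁ = pairs G.Adj W₁ W₂ := pairs_swap fun _ _ h => h.symm
    rw [← hWu, pairs_union_left hdisj, pairs_union_right hdisj, pairs_union_right hdisj]
    linarith
  have hcol : pairs (fun a b => G.Adj a b ∧ A.Adj (f₁ a) (f₁ b)) W₁ W₁ +
      pairs (fun a b => G.Adj a b ∧ A.Adj (f₂ a) (f₂ b)) W₂ W₂ ≤
      pairs (fun a b => G.Adj a b ∧ A.Adj (f a) (f b)) W W := by
    rw [← hWu, pairs_union_left hdisj]
    refine add_le_add ?_ ?_
    · exact pairs_mono subset_rfl Finset.subset_union_left fun a ha b hb h => by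
        rwa [e₁ a ha, e₁ b hb]
    · exact pairs_mono subset_rfl Finset.subset_union_right fun a ha b hb h => by
        rwa [e₂ a ha, e₂ b hb]
  linarith

/-- With an independent third of `G` placed on `Q`, every edge of `G` lands on an edge of `A`. -/
lemma HasEmb.of_clique_join {t : ℕ} (hP : P.card = 2 * t) (hQ : Q.card = t)
    (hPQ : Disjoint P Q) (hcl : A.IsClique (P : Set V)) (hadj : ∀ p ∈ P, ∀ q ∈ Q, A.Adj p q) :
    HasEmb A (P ∪ Q) (6 * t) := by
  intro G hG W hW
  rw [Finset.card_union_of_disjoint hPQ] at hW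
  obtain ⟨Z, hZW, hZ, hind⟩ := exists_independent hG W t (by omega)
  have hcard := Finset.card_sdiff_add_card_eq_card hZW
  obtain ⟨f₁, b₁⟩ := exists_bijOn (W := W \ Z) (U := P) (by omega)
  obtain ⟨f₂, b₂⟩ := exists_bijOn (W := Z) (U := Q) (by omega)
  obtain ⟨f, b, e₁, e₂⟩ := exists_bijOn_union b₁ b₂ Finset.sdiff_disjoint hPQ
  rw [Finset.sdiff_union_of_subset hZW] at b
  refine ⟨f, b, ?_⟩
  have h1 := pairs_le_two_mul hG (S := W) (T := W)
  have m₁ : ∀ a ∈ W, a ∉ Z → f a ∈ P := fun a ha haZ => by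
    have := Finset.mem_sdiff.2 ⟨ha, haZ⟩
    rw [e₁ a this]; exact b₁.mapsTo this
  have m₂ : ∀ a ∈ Z, f a ∈ Q := fun a ha => by rw [e₂ a ha]; exact b₂.mapsTo ha
  have h2 : pairs G.Adj W W ≤ pairs (fun a b => G.Adj a b ∧ A.Adj (f a) (f b)) W W := by
    refine pairs_mono subset_rfl subset_rfl fun x hx y hy hxy => ⟨hxy, ?_⟩
    by_cases hxZ : x ∈ Z <;> by_cases hyZ : y ∈ Z
    · exact absurd hxy (hind x hxZ y hyZ)
    · exact (hadj _ (m₁ y hy hyZ) _ (m₂ x hxZ)).symm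
    · exact hadj _ (m₁ x hx hxZ) _ (m₂ y hyZ)
    · exact hcl (m₁ x hx hxZ) (m₁ y hy hyZ) fun he => hxy.ne (b.injOn hx hy he)
  have h3 : (W.card : ℝ) = 3 * t := by
    rw [hW, hP, hQ]; push_cast; ring
  linarith

/-- An independent third of `G` goes to `P`, so all edges at it lie in the join. An edge missing
there loses both of its ordered pairs, which is why `HasEmb` charges deficiency twice. -/
lemma HasEmb.of_join {t : ℕ} (hP : P.card = t) (hQ : Q.card = 2 * t)
    (hPQ : Disjoint P Q) (hadj : ∀ p ∈ P, ∀ q ∈ Q, A.Adj p q) :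
    HasEmb A (P ∪ Q) (4 * t) := by
  intro G hG W hW
  rw [Finset.card_union_of_disjoint hPQ] at hW
  obtain ⟨Z, hZW, hZ, hind⟩ := exists_independent hG W t (by omega)
  have hcard := Finset.card_sdiff_add_card_eq_card hZW
  obtain ⟨f₁, b₁⟩ := exists_bijOn (W := W \ Z) (U := Q) (by omega)
  obtain ⟨f₂, b₂⟩ := exists_bijOn (W := Z) (U := P) (by omega)
  obtain ⟨f, b, e₁, e₂⟩ := exists_bijOn_union b₁ b₂ Finset.sdiff_disjoint hPQ.symm
  rw [Finset.sdiff_union_of_subset hZW, Finset.union_comm] at b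
  refine ⟨f, b, ?_⟩
  have m₁ : ∀ a ∈ W \ Z, f a ∈ Q := fun a ha => by rw [e₁ a ha]; exact b₁.mapsTo ha
  have m₂ : ∀ a ∈ Z, f a ∈ P := fun a ha => by rw [e₂ a ha]; exact b₂.mapsTo ha
  have hd : Disjoint (W \ Z) Z := Finset.sdiff_disjoint
  have hu : (W \ Z) ∪ Z = W := Finset.sdiff_union_of_subset hZW
  have hZZ : pairs G.Adj Z Z = 0 := pairs_eq_zero hind
  have hsw : pairs G.Adj (W \ Z) Z = pairs G.Adj Z (W \ Z) := pairs_swap fun _ _ h => h.symm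
  have hWW : pairs G.Adj W W = pairs G.Adj (W \ Z) W + pairs G.Adj Z (W \ Z) := by
    conv_lhs => rw [← hu, pairs_union_left hd, hu]
    congr 1
    conv_lhs => rw [← hu]
    rw [pairs_union_right hd, hZZ, add_zero]
  have h1 := pairs_le_two_mul hG (S := W \ Z) (T := W)
  have h2 : 2 * pairs G.Adj Z (W \ Z) ≤
      pairs (fun a b => G.Adj a b ∧ A.Adj (f a) (f b)) W W := by
    conv_rhs => rw [← hu, pairs_union_left hd]
    have i₁ : pairs G.Adj (W \ Z) Z ≤
        pairs (fun a b => G.Adj a b ∧ A.Adj (f a) (f b)) (W \ Z) (W \ Z ∪ Z) :=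
      pairs_mono subset_rfl Finset.subset_union_right fun x hx y hy hxy =>
        ⟨hxy, (hadj _ (m₂ y hy) _ (m₁ x hx)).symm⟩
    have i₂ : pairs G.Adj Z (W \ Z) ≤
        pairs (fun a b => G.Adj a b ∧ A.Adj (f a) (f b)) Z (W \ Z ∪ Z) :=
      pairs_mono subset_rfl Finset.subset_union_left fun x hx y hy hxy =>
        ⟨hxy, hadj _ (m₂ x hx) _ (m₁ y hy)⟩
    linarith
  have h3 : (W.card : ℝ) = 3 * t := by
    rw [hW, hP, hQ]; push_cast; ring
  have h4 : ((W \ Z).card : ℝ) = 2 * t := by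
    rw [show (W \ Z).card = 2 * t by omega]; push_cast; ring
  linarith

end HasEmb

/-! ### Ramsey-type extraction of cliques and monochromatic joins. -/

section Ramsey

universe u

/-- Ramsey's theorem for two colors. -/
lemma exists_ramsey (a b : ℕ) : ∃ N : ℕ, ∀ {V : Type u} (A : SimpleGraph V) (W : Finset V),
    N ≤ W.card → (∃ K ⊆ W, K.card = a ∧ A.IsClique (K : Set V)) ∨
      ∃ K ⊆ W, K.card = b ∧ Aᶜ.IsClique (K : Set V) := by
  induction a generalizing b with
  | zero => exact ⟨0, fun A W _ => Or.inl ⟨∅, by simp⟩⟩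
  | succ a iha =>
    induction b with
    | zero => exact ⟨0, fun A W _ => Or.inr ⟨∅, by simp⟩⟩
    | succ b ihb =>
      obtain ⟨N₁, h₁⟩ := iha (b + 1)
      obtain ⟨N₂, h₂⟩ := ihb
      refine ⟨N₁ + N₂ + 1, fun {V} A W hW => ?_⟩
      classical
      obtain ⟨v, hv⟩ := Finset.card_pos.1 (show 0 < W.card by omega)
      have hsum := Finset.card_filter_add_card_filter_not (s := W.erase v) (A.Adj v)
      rw [Finset.card_erase_of_mem hv] at hsum
      have hsub : ∀ (p : V → Prop) [DecidablePred p], (W.erase v).filter p ⊆ W := fun p _ =>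
        (Finset.filter_subset _ _).trans (Finset.erase_subset _ _)
      have extend : ∀ (B : SimpleGraph V) (K : Finset V) (p : V → Prop) [DecidablePred p] (c : ℕ),
          K ⊆ (W.erase v).filter p → (∀ w ∈ W.erase v, p w → B.Adj v w) → K.card = c →
          B.IsClique (K : Set V) →
          ∃ K' ⊆ W, K'.card = c + 1 ∧ B.IsClique (K' : Set V) := by
        intro B K p _ c hK hp hc hcl
        have hvK : v ∉ K := fun h => by simpa using hK h
        refine ⟨insert v K, Finset.insert_subset hv (hK.trans (hsub p)), by simp [hvK, hc], ?_⟩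
        rw [Finset.coe_insert]
        refine hcl.insert fun w hw _ => ?_
        have := Finset.mem_filter.1 (hK hw)
        exact hp w this.1 this.2
      by_cases hlt : N₁ ≤ ((W.erase v).filter (A.Adj v)).card
      · rcases h₁ A _ hlt with ⟨K, hK, hc, hcl⟩ | ⟨K, hK, hc, hcl⟩
        · exact Or.inl (extend A K _ a hK (fun _ _ h => h) hc hcl)
        · exact Or.inr ⟨K, hK.trans (hsub _), hc, hcl⟩
      · rcases h₂ A ((W.erase v).filter fun w => ¬ A.Adj v w) (by omega) with
          ⟨K, hK, hc, hcl⟩ | ⟨K, hK, hc, hcl⟩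
        · exact Or.inl ⟨K, hK.trans (hsub _), hc, hcl⟩
        · refine Or.inr (extend Aᶜ K _ b hK (fun w hw h => ?_) hc hcl)
          exact ⟨(Finset.ne_of_mem_erase hw).symm, h⟩

variable {V : Type u}

/-- Every subset of `R` with at least `h` vertices contains a clique of size `s`. -/
def Rich (A : SimpleGraph V) (s : ℕ) (h : ℝ) (R : Finset V) : Prop :=
  ∀ R' ⊆ R, h ≤ (R'.card : ℝ) → ∃ K ⊆ R', K.card = s ∧ A.IsClique (K : Set V)

lemma Rich.subset {A : SimpleGraph V} {s : ℕ} {h : ℝ} {R R' : Finset V} (hR : Rich A s h R)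
    (hs : R' ⊆ R) : Rich A s h R' :=
  fun S hS => hR S (hS.trans hs)

/-- Removing disjoint cliques of size `m` as long as possible leaves a set without them, and every
large part of the removed set contains a clique of size `s`. -/
lemma exists_clique_split [DecidableEq V] (A : SimpleGraph V) {m : ℕ} (hm : 0 < m) (s : ℕ)
    (W : Finset V) :
    ∃ R ⊆ W, (∀ K ⊆ W \ R, K.card = m → ¬ A.IsClique (K : Set V)) ∧
      ∀ R' ⊆ R, s * R.card < m * R'.card → ∃ K ⊆ R', K.card = s ∧ A.IsClique (K : Set V) := by
  induction W using Finset.strongInduction with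
  | H W ih =>
    by_cases hex : ∃ K ⊆ W, K.card = m ∧ A.IsClique (K : Set V)
    · obtain ⟨K, hKW, hK, hcl⟩ := hex
      have hne : K.Nonempty := Finset.card_pos.1 (by omega)
      obtain ⟨R, hRW, hno, hrich⟩ := ih (W \ K) (Finset.sdiff_ssubset hKW hne)
      have hRK : Disjoint R K := by
        rw [Finset.disjoint_left]; intro x hx; exact (Finset.mem_sdiff.1 (hRW hx)).2
      refine ⟨R ∪ K, Finset.union_subset (hRW.trans Finset.sdiff_subset) hKW, ?_, ?_⟩
      · intro L hL
        refine hno L (hL.trans ?_)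
        intro x; simp only [Finset.mem_sdiff, Finset.mem_union]; tauto
      · intro R' hR' hlt
        -- Otherwise deleting `K` lowers the left side of `hlt` by `s * m` and the right side by at
        -- most that, so the inequality survives.
        by_cases hs : s ≤ (R' ∩ K).card
        · obtain ⟨L, hL, hLs⟩ := Finset.exists_subset_card_eq hs
          exact ⟨L, hL.trans Finset.inter_subset_left, hLs,
            hcl.subset (by exact_mod_cast hL.trans Finset.inter_subset_right)⟩
        · have hsplit : (R' ∩ K).card + (R' \ K).card = R'.card :=
            Finset.card_inter_add_card_sdiff _ _
          obtain ⟨L, hL, hLs⟩ := hrich (R' \ K) (fun x hx => by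
            have hx := Finset.mem_sdiff.1 hx
            exact (Finset.mem_union.1 (hR' hx.1)).resolve_right hx.2) (by
            rw [Finset.card_union_of_disjoint hRK, hK] at hlt
            rw [← hsplit] at hlt
            have : m * (R' ∩ K).card ≤ m * s := Nat.mul_le_mul_left _ (by omega)
            nlinarith)
          exact ⟨L, hL.trans Finset.sdiff_subset, hLs⟩
    · push Not at hex
      refine ⟨∅, by simp, fun K hK => hex K (by simpa using hK), fun R' hR' hlt => ?_⟩
      rw [Finset.subset_empty.1 hR'] at hlt
      simp at hlt

/-- For every coloring the vertex set splits into a part in which `A`-cliques are abundant and one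
in which `Aᶜ`-cliques are abundant. -/
lemma exists_rich_split (s : ℕ) {ε : ℝ} (hε : 0 < ε) :
    ∃ N : ℕ, ∀ {V : Type u} [DecidableEq V] (A : SimpleGraph V) (W : Finset V), N ≤ W.card →
      ∃ R ⊆ W, Rich A s (ε * W.card) R ∧ Rich Aᶜ s (ε * W.card) (W \ R) := by
  -- This makes every `R'` of size at least `ε * W.card` satisfy `s * R.card < m * R'.card`.
  obtain ⟨m, hm⟩ := exists_nat_gt (s / ε)
  have hm0 : 0 < m := by
    have : (0 : ℝ) < m := lt_of_le_of_lt (by positivity) hm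
    exact_mod_cast this
  rw [div_lt_iff₀ hε] at hm
  obtain ⟨N₀, hN₀⟩ := exists_ramsey.{u} m s
  obtain ⟨N, hN⟩ := exists_nat_ge (N₀ / ε)
  rw [div_le_iff₀ hε] at hN
  refine ⟨N + 1, fun {V} _ A W hW => ?_⟩
  have hW0 : (0 : ℝ) < W.card := by exact_mod_cast (by omega : 0 < W.card)
  obtain ⟨R, hRW, hno, hrich⟩ := exists_clique_split A hm0 s W
  refine ⟨R, hRW, fun R' hR' hc => hrich R' hR' ?_, fun B hB hc => ?_⟩
  · have h1 : (R.card : ℝ) ≤ W.card := by exact_mod_cast Finset.card_le_card hRW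
    have : (s : ℝ) * R.card < m * R'.card :=
      calc (s : ℝ) * R.card ≤ s * W.card := by gcongr
        _ < m * ε * W.card := by gcongr
        _ = m * (ε * W.card) := by ring
        _ ≤ m * R'.card := by gcongr
    exact_mod_cast this
  · have : (N₀ : ℝ) ≤ B.card := by
      have h1 : (N : ℝ) ≤ W.card := by exact_mod_cast (by omega : N ≤ W.card)
      nlinarith
    rcases hN₀ A B (by exact_mod_cast this) with ⟨K, hK, hc, hcl⟩ | h
    · exact absurd hcl (hno K (hK.trans hB) hc)
    · exact h

/-- Two disjoint large sets contain parts of size `k` all of whose connecting edges have the same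
color. -/
lemma exists_mono_join [DecidableEq V] (A : SimpleGraph V) {X Y : Finset V} (hXY : Disjoint X Y)
    {k : ℕ} (hX : 4 ^ k * k ≤ X.card) (hY : 2 * k ≤ Y.card) :
    ∃ X' ⊆ X, ∃ Y' ⊆ Y, X'.card = k ∧ Y'.card = k ∧
      ((∀ x ∈ X', ∀ y ∈ Y', A.Adj x y) ∨ ∀ x ∈ X', ∀ y ∈ Y', Aᶜ.Adj x y) := by
  classical
  obtain ⟨Y₀, hY₀, hc⟩ := Finset.exists_subset_card_eq hY
  -- Pigeonhole over the `4 ^ k` possible neighbourhoods in the `2 * k`-set `Y₀`; then `S` or its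
  -- complement fills half of `Y₀`.
  obtain ⟨S, -, hS⟩ := Finset.exists_le_card_fiber_of_mul_le_card_of_maps_to
    (s := X) (t := Y₀.powerset) (f := fun x => Y₀.filter (A.Adj x)) (n := k)
    (fun x _ => Finset.mem_powerset.2 (Finset.filter_subset _ _)) ⟨∅, by simp⟩
    (by rw [Finset.card_powerset, hc, pow_mul]; exact hX)
  obtain ⟨X', hX', hcX'⟩ := Finset.exists_subset_card_eq hS
  have hfib : ∀ x ∈ X', x ∈ X ∧ Y₀.filter (A.Adj x) = S := fun x hx => by
    simpa using hX' hx
  have hX'X : X' ⊆ X := fun x hx => (hfib x hx).1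
  by_cases hk : k ≤ (Y₀ ∩ S).card
  · obtain ⟨Y', hY', hcY'⟩ := Finset.exists_subset_card_eq hk
    refine ⟨X', hX'X, Y', hY'.trans (Finset.inter_subset_left.trans hY₀), hcX', hcY', Or.inl ?_⟩
    intro x hx y hy
    have := (Finset.mem_inter.1 (hY' hy)).2
    rw [← (hfib x hx).2] at this
    exact (Finset.mem_filter.1 this).2
  · have := Finset.card_inter_add_card_sdiff Y₀ S
    obtain ⟨Y', hY', hcY'⟩ := Finset.exists_subset_card_eq (show k ≤ (Y₀ \ S).card by omega)
    refine ⟨X', hX'X, Y', hY'.trans (Finset.sdiff_subset.trans hY₀), hcX', hcY', Or.inr ?_⟩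
    intro x hx y hy
    obtain ⟨hy₀, hyS⟩ := Finset.mem_sdiff.1 (hY' hy)
    refine ⟨fun he => Finset.disjoint_left.1 hXY (hX'X hx) (he ▸ hY₀ hy₀), fun hadj => hyS ?_⟩
    rw [← (hfib x hx).2]
    exact Finset.mem_filter.2 ⟨hy₀, hadj⟩

end Ramsey

/-! ### Two-colored blocks and tilings by them. -/

section Blocks

variable {V : Type*} [DecidableEq V] {A : SimpleGraph V}

/-- The pair of values is (6t, 2t - 8) or (4t, 4t - 8), according to which side is larger: the same
sum. -/
lemma exists_emb_of_join {P Q : Finset V} {t : ℕ} (hPQ : Disjoint P Q)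
    (hcard : P.card = 2 * t ∧ Q.card = t ∨ P.card = t ∧ Q.card = 2 * t)
    (hP : A.IsClique (P : Set V)) (hQ : Aᶜ.IsClique (Q : Set V))
    (hadj : ∀ p ∈ P, ∀ q ∈ Q, A.Adj p q) :
    ∃ x y : ℝ, HasEmb A (P ∪ Q) x ∧ HasEmb Aᶜ (P ∪ Q) y ∧ 8 * (t : ℝ) - 8 ≤ x + y := by
  have hy : HasEmb Aᶜ (P ∪ Q) (0 + 2 * Q.card - 8) :=
    HasEmb.union HasEmb.zero (HasEmb.of_isClique hQ) hPQ
  rcases hcard with ⟨h₁, h₂⟩ | ⟨h₁, h₂⟩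
  · refine ⟨_, _, HasEmb.of_clique_join h₁ h₂ hPQ hP hadj, hy, ?_⟩
    rw [h₂]; linarith
  · refine ⟨_, _, HasEmb.of_join h₁ h₂ hPQ hadj, hy, ?_⟩
    rw [h₂]; push_cast; linarith

lemma exists_block {R B : Finset V} {s t : ℕ} {h : ℝ} (hRB : Disjoint R B)
    (hR : Rich A s h R) (hB : Rich Aᶜ s h B) (hs : 4 ^ (2 * t) * (2 * t) ≤ s)
    (hs' : 2 * (2 * t) ≤ s) (hcR : h ≤ R.card) (hcB : h ≤ B.card) {p q : ℕ}
    (hpq : p = 2 * t ∧ q = t ∨ p = t ∧ q = 2 * t) :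
    ∃ P ⊆ R, ∃ Q ⊆ B, P.card = p ∧ Q.card = q ∧ ∃ x y : ℝ,
      HasEmb A (P ∪ Q) x ∧ HasEmb Aᶜ (P ∪ Q) y ∧ 8 * (t : ℝ) - 8 ≤ x + y := by
  obtain ⟨X, hXR, hX, hXcl⟩ := hR R subset_rfl hcR
  obtain ⟨Y, hYB, hY, hYcl⟩ := hB B subset_rfl hcB
  obtain ⟨X', hX', Y', hY', hcX, hcY, hmono⟩ := exists_mono_join A
    (Finset.disjoint_of_subset_left hXR (Finset.disjoint_of_subset_right hYB hRB))
    (k := 2 * t) (by omega) (by omega)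
  obtain ⟨P, hP, hcP⟩ := Finset.exists_subset_card_eq (show p ≤ X'.card by omega)
  obtain ⟨Q, hQ, hcQ⟩ := Finset.exists_subset_card_eq (show q ≤ Y'.card by omega)
  have hPX := hP.trans hX'
  have hQY := hQ.trans hY'
  have hPQ : Disjoint P Q := Finset.disjoint_of_subset_left (hPX.trans hXR)
    (Finset.disjoint_of_subset_right (hQY.trans hYB) hRB)
  have hPcl : A.IsClique (P : Set V) := hXcl.subset (by exact_mod_cast hPX)
  have hQcl : Aᶜ.IsClique (Q : Set V) := hYcl.subset (by exact_mod_cast hQY)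
  refine ⟨P, hPX.trans hXR, Q, hQY.trans hYB, hcP, hcQ, ?_⟩
  rcases hmono with hm | hm
  · exact exists_emb_of_join (t := t) hPQ (by omega) hPcl hQcl fun x hx y hy => hm x (hP hx) y (hQ hy)
  -- If the join has color `Aᶜ`, the colors and the two sides exchange roles.
  · obtain ⟨y, x, h₁, h₂, h₃⟩ := exists_emb_of_join (A := Aᶜ) (t := t) hPQ.symm (by omega) hQcl
      (by rwa [compl_compl]) fun y hy x hx => (hm x (hP hx) y (hQ hy)).symm
    rw [compl_compl, Finset.union_comm] at h₂
    rw [Finset.union_comm] at h₁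
    exact ⟨x, y, h₂, h₁, by linarith⟩

/-- Each block of 3t vertices contributes 8t - 8, less 8 per color for the union: 8t - 24 = (8/3 -
8/t) · 3t. -/
lemma exists_emb_balanced {s t : ℕ} {h : ℝ} (ht : 0 < t) (hs : 4 ^ (2 * t) * (2 * t) ≤ s)
    (hs' : 2 * (2 * t) ≤ s) (hth : 3 * (t : ℝ) ≤ h) (n : ℕ) :
    ∀ R B : Finset V, Disjoint R B → R.card + B.card = n → Rich A s h R → Rich Aᶜ s h B →
      R.card ≤ 2 * B.card → B.card ≤ 2 * R.card →
      ∃ x y : ℝ, HasEmb A (R ∪ B) x ∧ HasEmb Aᶜ (R ∪ B) y ∧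
        (8 / 3 - 8 / t) * (n : ℝ) - 8 * h ≤ x + y := by
  induction n using Nat.strong_induction_on with
  | _ n ih =>
    intro R B hRB hn hR hB h₁ h₂
    have htR : (0 : ℝ) < t := by exact_mod_cast ht
    by_cases hsmall : (R.card : ℝ) < h ∨ (B.card : ℝ) < h
    -- Balance forces `n ≤ 3 * h`, and `8 * h` pays for all remaining vertices.
    · refine ⟨0, 0, HasEmb.zero, HasEmb.zero, ?_⟩
      have h₁' : (R.card : ℝ) ≤ 2 * B.card := by exact_mod_cast h₁
      have h₂' : (B.card : ℝ) ≤ 2 * R.card := by exact_mod_cast h₂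
      have hn' : (R.card : ℝ) + B.card = n := by exact_mod_cast hn
      have h3 : (n : ℝ) ≤ 3 * h := by rcases hsmall with h | h <;> linarith
      have : 0 ≤ 8 / (t : ℝ) * n := by positivity
      linarith
    · push Not at hsmall
      have hRt : 3 * t ≤ R.card := by exact_mod_cast hth.trans hsmall.1
      have hBt : 3 * t ≤ B.card := by exact_mod_cast hth.trans hsmall.2
      -- Taking the 2t vertices from the larger part keeps both ratios at most 2, since both parts
      -- have at least 3t vertices.
      obtain ⟨p, q, hpq, hp, hq⟩ : ∃ p q : ℕ, (p = 2 * t ∧ q = t ∨ p = t ∧ q = 2 * t) ∧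
          R.card - p ≤ 2 * (B.card - q) ∧ B.card - q ≤ 2 * (R.card - p) := by
        rcases le_total B.card R.card with hle | hle
        · exact ⟨2 * t, t, by omega, by omega, by omega⟩
        · exact ⟨t, 2 * t, by omega, by omega, by omega⟩
      obtain ⟨P, hP, Q, hQ, hcP, hcQ, x₁, y₁, hx₁, hy₁, hxy₁⟩ :=
        exists_block hRB hR hB hs hs' hsmall.1 hsmall.2 hpq
      have hcR := Finset.card_sdiff_of_subset hP
      have hcB := Finset.card_sdiff_of_subset hQ
      have hd : Disjoint (R \ P) (B \ Q) := Finset.disjoint_of_subset_left Finset.sdiff_subset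
        (Finset.disjoint_of_subset_right Finset.sdiff_subset hRB)
      obtain ⟨x₂, y₂, hx₂, hy₂, hxy₂⟩ := ih (n - 3 * t) (by omega) (R \ P) (B \ Q) hd
        (by omega) (hR.subset Finset.sdiff_subset) (hB.subset Finset.sdiff_subset)
        (by omega) (by omega)
      have hd' : Disjoint (P ∪ Q) (R \ P ∪ B \ Q) := by
        rw [Finset.disjoint_left] at hRB ⊢
        grind
      have hu : (P ∪ Q) ∪ (R \ P ∪ B \ Q) = R ∪ B := by grind
      have hx := hx₁.union hx₂ hd'
      have hy := hy₁.union hy₂ hd'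
      rw [hu] at hx hy
      refine ⟨_, _, hx, hy, ?_⟩
      have hnt : ((n - 3 * t : ℕ) : ℝ) = n - 3 * t := by
        rw [Nat.cast_sub (by omega)]; push_cast; ring
      rw [hnt] at hxy₂
      have : (8 / 3 - 8 / (t : ℝ)) * (n - 3 * t) = (8 / 3 - 8 / t) * n - (8 * t - 24) := by
        field_simp
        ring
      linarith

/-- Cliques of size `s` are removed greedily; each yields `2 * s` less 8 for the union, and fewer
than `h` vertices remain. -/
lemma exists_emb_rich {s : ℕ} {h : ℝ} (hs : 0 < s) (R : Finset V) :
    Rich A s h R → ∃ x : ℝ, HasEmb A R x ∧ (2 - 8 / s) * (R.card : ℝ) - 2 * h ≤ x := by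
  induction R using Finset.strongInduction with
  | H R ih =>
    intro hR
    have hsR : (0 : ℝ) < s := by exact_mod_cast hs
    by_cases hsmall : (R.card : ℝ) < h
    · refine ⟨0, HasEmb.zero, ?_⟩
      have : 0 ≤ 8 / (s : ℝ) * R.card := by positivity
      linarith
    · obtain ⟨K, hKR, hK, hcl⟩ := hR R subset_rfl (not_lt.1 hsmall)
      obtain ⟨x, hx, hle⟩ := ih (R \ K)
        (Finset.sdiff_ssubset hKR (Finset.card_pos.1 (by omega))) (hR.subset Finset.sdiff_subset)
      have hu := (HasEmb.of_isClique hcl).union hx Finset.disjoint_sdiff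
      rw [Finset.union_sdiff_of_subset hKR] at hu
      refine ⟨_, hu, ?_⟩
      rw [Finset.cast_card_sdiff hKR, hK] at hle
      rw [hK]
      have : (2 - 8 / (s : ℝ)) * (R.card - s) = (2 - 8 / s) * R.card - (2 * s - 8) := by
        field_simp
      linarith

end Blocks

-- The asymptotic bound for one color.

universe u

lemma exists_emb_of_large_rich {V : Type u} [DecidableEq V] {A : SimpleGraph V} {W R : Finset V}
    {s : ℕ} {h : ℝ} (hs : 0 < s) (hRW : R ⊆ W) (hR : Rich A s h R)
    (hc : 2 * W.card ≤ 3 * R.card) :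
    HasEmb A W ((4 / 3 - 8 / s) * W.card - 2 * h - 8) := by
  obtain ⟨x, hx, hle⟩ := exists_emb_rich hs R hR
  have hu := hx.union (HasEmb.zero (U := W \ R)) Finset.disjoint_sdiff
  rw [Finset.union_sdiff_of_subset hRW] at hu
  refine hu.mono ?_
  have h1 : 2 * (W.card : ℝ) ≤ 3 * R.card := by exact_mod_cast hc
  have h2 : (R.card : ℝ) ≤ W.card := by exact_mod_cast Finset.card_le_card hRW
  have h3 : 8 / (s : ℝ) * R.card ≤ 8 / s * W.card := by gcongr
  linarith

/-- Asymptotically, one of the two colors admits embeddings with two thirds of the edges. -/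
lemma exists_emb {η : ℝ} (hη : 0 < η) : ∃ N : ℕ, ∀ {V : Type u} [DecidableEq V]
    (A : SimpleGraph V) (W : Finset V), N ≤ W.card →
      HasEmb A W ((4 / 3 - η) * W.card) ∨ HasEmb Aᶜ W ((4 / 3 - η) * W.card) := by
  obtain ⟨t, ht⟩ := exists_nat_gt (16 / η)
  have htR : (0 : ℝ) < t := lt_trans (by positivity) ht
  have ht0 : 0 < t := by exact_mod_cast htR
  have h8t : 8 / (t : ℝ) ≤ η / 2 := by
    rw [div_lt_iff₀ hη] at ht
    rw [div_le_iff₀ htR]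
    linarith
  set s := 4 ^ (2 * t) * (2 * t) + 2 * (2 * t) with hs
  have hts : (t : ℝ) ≤ s := by exact_mod_cast (by omega : t ≤ s)
  have h8s : 8 / (s : ℝ) ≤ η / 2 := le_trans (by gcongr) h8t
  -- With ε = η/16 the loss `8 * h` is half of `η * W.card`.
  obtain ⟨N₁, hN₁⟩ := exists_rich_split.{u} s (ε := η / 16) (by positivity)
  obtain ⟨N₂, hN₂⟩ := exists_nat_ge ((48 * (t : ℝ) + 32) / η)
  rw [div_le_iff₀ hη] at hN₂
  refine ⟨N₁ + N₂, fun {V} _ A W hW => ?_⟩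
  obtain ⟨R, hRW, hR, hB⟩ := hN₁ A W (by omega)
  set h := η / 16 * (W.card : ℝ) with hdef
  have hWN : (N₂ : ℝ) ≤ W.card := by exact_mod_cast (by omega : N₂ ≤ W.card)
  have hηW : 48 * (t : ℝ) + 32 ≤ η * W.card := by nlinarith
  have hcard := Finset.card_sdiff_add_card_eq_card hRW
  have hs8W : 8 / (s : ℝ) * W.card ≤ η / 2 * W.card := by gcongr
  have ht8W : 8 / (t : ℝ) * W.card ≤ η / 2 * W.card := by gcongr
  by_cases h₁ : R.card ≤ 2 * (W \ R).card
  · by_cases h₂ : (W \ R).card ≤ 2 * R.card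
    · obtain ⟨x, y, hx, hy, hxy⟩ := exists_emb_balanced (A := A) ht0 (s := s) (by omega)
        (by omega) (h := h) (by linarith) W.card R (W \ R) Finset.disjoint_sdiff (by omega)
        hR hB h₁ h₂
      rw [Finset.union_sdiff_of_subset hRW] at hx hy
      -- Here `x + y` is at least twice the target.
      by_cases hle : (4 / 3 - η) * (W.card : ℝ) ≤ x
      · exact Or.inl (hx.mono hle)
      · exact Or.inr (hy.mono (by linarith))
    · refine Or.inr ((exists_emb_of_large_rich (s := s) (h := h) (by omega)
        Finset.sdiff_subset hB (by omega)).mono (by linarith))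
  · refine Or.inl ((exists_emb_of_large_rich (s := s) (h := h) (by omega)
      hRW hR (by omega)).mono (by linarith))

/-! ### From ordered pairs to edge counts of copies. -/

section Counting

variable {n : ℕ}

lemma two_mul_colorCount (c : Coloring n) (H : SimpleGraph (Fin n)) (i : Bool) :
    2 * (colorCount c H i : ℝ) =
      pairs (fun a b => H.Adj a b ∧ (c.labelGraph i).Adj a b) Finset.univ Finset.univ := by
  classical
  set G := H ⊓ c.labelGraph i with hG
  have h1 : colorCount c H i = G.edgeFinset.card := by
    rw [← Set.ncard_coe_finset, SimpleGraph.coe_edgeFinset, hG, SimpleGraph.edgeSet_inf]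
    rfl
  have h2 := G.sum_degrees_eq_twice_card_edges
  have h3 : ∀ v, (G.degree v : ℝ) =
      ∑ b, if H.Adj v b ∧ (c.labelGraph i).Adj v b then (1 : ℝ) else 0 := by
    intro v
    rw [Finset.sum_boole, ← SimpleGraph.card_neighborFinset_eq_degree]
    congr 2
    ext b
    simp [hG]
  rw [h1, pairs]
  calc (2 : ℝ) * G.edgeFinset.card = ((2 * G.edgeFinset.card : ℕ) : ℝ) := by push_cast; ring
    _ = ∑ v, (G.degree v : ℝ) := by
        rw [← Nat.cast_sum]
        congr 1
        convert h2.symm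
    _ = _ := Finset.sum_congr rfl fun v _ => by rw [h3 v]; congr! 

lemma pairs_singleton_of_regular {F : SimpleGraph (Fin n)} [F.LocallyFinite]
    (hF : F.IsRegularOfDegree 2) (v : Fin n) : pairs F.Adj {v} Finset.univ = 2 := by
  classical
  have : Finset.univ.filter (F.Adj v) = F.neighborFinset v := by ext; simp
  have h := hF v
  rw [← SimpleGraph.card_neighborFinset_eq_degree, ← this] at h
  rw [pairs, Finset.sum_singleton, Finset.sum_boole]
  exact_mod_cast (by convert h : _ = 2)

lemma pairs_univ_of_regular {F : SimpleGraph (Fin n)} [F.LocallyFinite]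
    (hF : F.IsRegularOfDegree 2) (S : Finset (Fin n)) :
    pairs F.Adj S Finset.univ = 2 * (S.card : ℝ) := by
  rw [pairs_eq_sum, Finset.sum_congr rfl fun v _ => pairs_singleton_of_regular hF v]
  simp [mul_comm]

lemma maxDegTwo_of_regular {F : SimpleGraph (Fin n)} [F.LocallyFinite]
    (hF : F.IsRegularOfDegree 2) : MaxDegTwo F := fun v T =>
  (pairs_mono subset_rfl (Finset.subset_univ T) fun _ _ _ _ h => h).trans
    (pairs_singleton_of_regular hF v).le

lemma labelGraph_false_eq_compl (c : Coloring n) : c.labelGraph false = (c.labelGraph true)ᶜ := by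
  ext a b
  rw [SimpleGraph.compl_adj, SimpleGraph.TopEdgeLabeling.labelGraph_adj,
    SimpleGraph.TopEdgeLabeling.labelGraph_adj]
  grind

lemma HasEmb.exists_copy {c : Coloring n} {i : Bool} {y : ℝ}
    (h : HasEmb (c.labelGraph i) Finset.univ y) (F : SimpleGraph (Fin n)) [F.LocallyFinite]
    (hF : F.IsRegularOfDegree 2) :
    ∃ H : SimpleGraph (Fin n), Nonempty (F ≃g H) ∧ y ≤ 2 * (colorCount c H i : ℝ) := by
  obtain ⟨f, hf, hle⟩ := h F (maxDegTwo_of_regular hF) Finset.univ rfl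
  rw [Finset.coe_univ, Set.bijOn_univ] at hf
  set e := Equiv.ofBijective f hf
  refine ⟨F.comap e.symm, ⟨(SimpleGraph.Iso.comap e.symm F).symm⟩, ?_⟩
  rw [two_mul_colorCount]
  have hpairs : pairs (fun a b => (F.comap e.symm).Adj a b ∧ (c.labelGraph i).Adj a b)
      Finset.univ Finset.univ =
      pairs (fun a b => F.Adj a b ∧ (c.labelGraph i).Adj (f a) (f b))
        Finset.univ Finset.univ := by
    unfold pairs
    rw [← Equiv.sum_comp e]
    refine Finset.sum_congr rfl fun a _ => ?_
    rw [← Equiv.sum_comp e]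
    refine Finset.sum_congr rfl fun b _ => ?_
    congr 1
    beta_reduce
    rw [SimpleGraph.comap_adj, e.symm_apply_apply, e.symm_apply_apply]
    rfl
  rw [hpairs]
  rw [pairs_univ_of_regular hF] at hle
  linarith

end Counting

/-! ### A uniform error term. -/

/-- Every 2-factor on `n` vertices has, under every coloring, a copy with `q * n` edges of one
color. -/
def ForcedRatio (n : ℕ) (q : ℝ) : Prop :=
  ∀ (F : SimpleGraph (Fin n)) [F.LocallyFinite], F.IsRegularOfDegree 2 →
    ∀ c : Coloring n, ∃ H : SimpleGraph (Fin n), Nonempty (F ≃g H) ∧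
      ∃ i : Bool, q * (n : ℝ) ≤ (colorCount c H i : ℝ)

lemma ForcedRatio.mono {n : ℕ} {q q' : ℝ} (h : ForcedRatio n q) (hq : q' ≤ q) :
    ForcedRatio n q' := by
  intro F _ hF c
  obtain ⟨H, hH, i, hi⟩ := h F hF c
  exact ⟨H, hH, i, le_trans (by gcongr) hi⟩

lemma forcedRatio_zero (n : ℕ) : ForcedRatio n 0 :=
  fun F _ _ _ => ⟨F, ⟨SimpleGraph.Iso.refl⟩, true, by simp⟩

lemma eventually_forcedRatio {η : ℝ} (hη : 0 < η) :
    ∀ᶠ n in atTop, ForcedRatio n (2 / 3 - η) := by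
  obtain ⟨N, hN⟩ := exists_emb.{0} hη
  filter_upwards [eventually_ge_atTop N] with n hn F _ hF c
  have key : ∀ i, HasEmb (c.labelGraph i) Finset.univ ((4 / 3 - η) * n) →
      ∃ H : SimpleGraph (Fin n), Nonempty (F ≃g H) ∧
        ∃ i : Bool, (2 / 3 - η) * (n : ℝ) ≤ (colorCount c H i : ℝ) := by
    intro i h
    obtain ⟨H, hH, hle⟩ := h.exists_copy F hF
    have : 0 ≤ η * n := by positivity
    exact ⟨H, hH, i, by linarith⟩
  have hcard : (Finset.univ : Finset (Fin n)).card = n := by simp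
  have h := hN (c.labelGraph true) (Finset.univ : Finset (Fin n)) (by omega)
  rw [← labelGraph_false_eq_compl, hcard] at h
  exact h.elim (key true) (key false)

lemma guaranteed_two_thirds : Guaranteed (2 / 3) := by
  set D : ℕ → Set ℝ := fun n => {η | 0 ≤ η ∧ ForcedRatio n (2 / 3 - η)}
  have hbdd : ∀ n, BddBelow (D n) := fun n => ⟨0, fun η h => h.1⟩
  have hne : ∀ n, (D n).Nonempty := fun n =>
    ⟨2 / 3, by norm_num, by simpa using forcedRatio_zero n⟩
  have hnonneg : ∀ n, 0 ≤ sInf (D n) := fun n => le_csInf (hne n) fun η h => h.1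
  -- The extra `1 / (n + 1)` avoids having to show that the infimum is attained.
  refine ⟨fun n => sInf (D n) + 1 / ((n : ℝ) + 1), ?_, fun n F _ hF c => ?_⟩
  · have h0 : Tendsto (fun n => sInf (D n)) atTop (𝓝 0) := by
      rw [Metric.tendsto_nhds]
      intro ε hε
      filter_upwards [eventually_forcedRatio (half_pos hε)] with n hn
      have : sInf (D n) ≤ ε / 2 := csInf_le (hbdd n) ⟨by positivity, hn⟩
      rw [Real.dist_eq, sub_zero, abs_of_nonneg (hnonneg n)]
      linarith
    simpa using h0.add tendsto_one_div_add_atTop_nhds_zero_nat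
  · obtain ⟨η, hη, hlt⟩ := exists_lt_of_csInf_lt (hne n)
      (lt_add_of_pos_right (sInf (D n)) (show (0 : ℝ) < 1 / ((n : ℝ) + 1) by positivity))
    exact hη.2.mono (by linarith) F hF c

/-! ### The extremal construction and optimality. -/

lemma bipartiteConstruction_adj {n : ℕ} {X : Finset (Fin n)} {a i : Bool} {u v : Fin n}
    (h : ((bipartiteConstruction X a).labelGraph i).Adj u v) :
    (u ∈ X ∨ v ∈ X) ∧ i = a ∨ (u ∉ X ∧ v ∉ X) ∧ i = !a := by
  rw [SimpleGraph.TopEdgeLabeling.labelGraph_adj] at h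
  obtain ⟨hne, h⟩ := h
  rw [SimpleGraph.EdgeLabeling.get, bipartiteConstruction] at h
  simp only [Sym2.mem_iff] at h
  split_ifs at h with hex
  · obtain ⟨w, hw, rfl | rfl⟩ := hex
    · exact Or.inl ⟨Or.inl hw, h.symm⟩
    · exact Or.inl ⟨Or.inr hw, h.symm⟩
  · exact Or.inr ⟨⟨fun hu => hex ⟨u, hu, Or.inl rfl⟩, fun hv => hex ⟨v, hv, Or.inr rfl⟩⟩, h.symm⟩

lemma colorCount_bipartiteConstruction_le {n : ℕ} {X : Finset (Fin n)} {a : Bool}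
    (hX : (X.card : ℝ) = (1 / 3) * (n : ℝ)) {H : SimpleGraph (Fin n)} [H.LocallyFinite]
    (hH : H.IsRegularOfDegree 2) (i : Bool) :
    (colorCount (bipartiteConstruction X a) H i : ℝ) ≤ (2 / 3) * (n : ℝ) := by
  have h := two_mul_colorCount (bipartiteConstruction X a) H i
  have hu : X ∪ Xᶜ = Finset.univ := Finset.union_compl X
  have hd : Disjoint X Xᶜ := disjoint_compl_right
  have hXc : (Xᶜ.card : ℝ) = n - X.card := by
    rw [Finset.card_compl, Nat.cast_sub (Finset.card_le_univ X), Fintype.card_fin]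
  rw [← hu, pairs_union_left hd] at h
  by_cases hi : i = a
  · have h1 := pairs_univ_of_regular hH X
    have h2 : pairs (fun u v => H.Adj u v ∧ ((bipartiteConstruction X a).labelGraph i).Adj u v)
        X (X ∪ Xᶜ) ≤ pairs H.Adj X Finset.univ :=
      pairs_mono subset_rfl (Finset.subset_univ _) fun _ _ _ _ h => h.1
    have h3 : pairs (fun u v => H.Adj u v ∧ ((bipartiteConstruction X a).labelGraph i).Adj u v)
        Xᶜ (X ∪ Xᶜ) ≤ pairs H.Adj Xᶜ X := by
      rw [pairs_union_right hd, pairs_eq_zero (T := Xᶜ), add_zero]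
      · exact pairs_mono subset_rfl subset_rfl fun _ _ _ _ h => h.1
      · intro u hu v hv h
        have := bipartiteConstruction_adj h.2
        simp only [Finset.mem_compl] at hu hv
        grind
    have h4 : pairs H.Adj Xᶜ X ≤ pairs H.Adj X Finset.univ := by
      rw [pairs_swap fun _ _ h => h.symm]
      exact pairs_mono subset_rfl (Finset.subset_univ _) fun _ _ _ _ h => h
    linarith
  · have h1 := pairs_univ_of_regular hH Xᶜ
    have h2 : pairs (fun u v => H.Adj u v ∧ ((bipartiteConstruction X a).labelGraph i).Adj u v)
        Xᶜ (X ∪ Xᶜ) ≤ pairs H.Adj Xᶜ Finset.univ :=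
      pairs_mono subset_rfl (Finset.subset_univ _) fun _ _ _ _ h => h.1
    have h3 : pairs (fun u v => H.Adj u v ∧ ((bipartiteConstruction X a).labelGraph i).Adj u v)
        X (X ∪ Xᶜ) = 0 := pairs_eq_zero fun u hu v _ h => by
      have := bipartiteConstruction_adj h.2
      grind
    linarith

lemma colorCount_bipartiteConstruction_le_of_iso {n : ℕ} {X : Finset (Fin n)} {a : Bool}
    (hX : (X.card : ℝ) = (1 / 3) * (n : ℝ)) {F H : SimpleGraph (Fin n)} [F.LocallyFinite]
    (hF : F.IsRegularOfDegree 2) (e : F ≃g H) (i : Bool) :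
    (colorCount (bipartiteConstruction X a) H i : ℝ) ≤ (2 / 3) * (n : ℝ) := by
  classical
  refine colorCount_bipartiteConstruction_le hX (fun v => ?_) i
  rw [← hF (e.symm v), ← e.degree_eq (e.symm v), e.apply_symm_apply]

lemma le_two_thirds_of_guaranteed {r : ℝ} (hr : Guaranteed r) : r ≤ 2 / 3 := by
  obtain ⟨δ, hδ, h⟩ := hr
  -- Positive multiples of 3 allow |X| = n/3 exactly and make the n-cycle a 2-factor.
  have hsub : Tendsto (fun k : ℕ => 3 * (k + 1)) atTop atTop :=
    tendsto_atTop_mono (fun k => show k ≤ 3 * (k + 1) by omega) tendsto_id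
  have hlim : Tendsto (fun k : ℕ => r - δ (3 * (k + 1))) atTop (𝓝 (r - 0)) :=
    tendsto_const_nhds.sub (hδ.comp hsub)
  rw [sub_zero] at hlim
  refine le_of_tendsto' hlim fun k => ?_
  have hreg : (SimpleGraph.cycleGraph (3 * k + 3)).IsRegularOfDegree 2 :=
    fun v => SimpleGraph.cycleGraph_degree_three_le
  obtain ⟨X, -, hX⟩ := Finset.exists_subset_card_eq
    (show k + 1 ≤ (Finset.univ : Finset (Fin (3 * k + 3))).card by simp; omega)
  obtain ⟨H, ⟨e⟩, i, hi⟩ := h (3 * k + 3) _ hreg (bipartiteConstruction X true)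
  have hle := colorCount_bipartiteConstruction_le_of_iso (X := X) (a := true)
    (by rw [hX]; push_cast; ring) hreg e i
  have hpos : (0 : ℝ) < ((3 * k + 3 : ℕ) : ℝ) := by positivity
  exact le_of_mul_le_mul_right (hi.trans hle) hpos

end TwoFactor

theorem theorem4 :
    TwoFactor.Guaranteed (2 / 3) ∧
    (∀ r : ℝ, TwoFactor.Guaranteed r → r ≤ 2 / 3) ∧
    (∀ (n : ℕ) (X : Finset (Fin n)) (a : Bool), (X.card : ℝ) = (1 / 3) * (n : ℝ) →
      ∀ (F : SimpleGraph (Fin n)) [F.LocallyFinite], F.IsRegularOfDegree 2 →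
        ∀ H : SimpleGraph (Fin n), Nonempty (F ≃g H) → ∀ i : Bool,
          (TwoFactor.colorCount (TwoFactor.bipartiteConstruction X a) H i : ℝ)
            ≤ (2 / 3) * (n : ℝ)) :=
  ⟨TwoFactor.guaranteed_two_thirds, fun _ => TwoFactor.le_two_thirds_of_guaranteed,
    fun _ _ _ hX _ _ hF _ ⟨e⟩ i =>
      TwoFactor.colorCount_bipartiteConstruction_le_of_iso hX hF e i⟩
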